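/- Let $(\mathbb{E},\circ)$ be a (finite-dimensional, real) Euclidean Jordan algebra with identity $e$: $\circ$ is commutative and bilinear, $x\circ(x^2\circ y)=x^2\circ(x\circ y)$ where $x^2=x\circ x$, and $\mathbb{E}$ carries an inner product with respect to which every map $y\mapsto x\circ y$ is symmetric. Let $\mathcal{K}=\{x\circ x : x\in\mathbb{E}\}$ be its symmetric cone. A primitive idempotent is a nonzero $c$ with $c\circ c=c$ that is not the sum of two nonzero idempotents. A Jordan frame is a family $c_1,\dots,c_r$ of primitive idempotents with $c_i\circ c_j=0$ for $i\ne j$ and $\sum_i c_i=e$. Each $x\in\mathbb{E}$ can be written $x=\sum_{i=1}^r\lambda_i c_i$ with real $\lambda_i$ and some Jordan frame $c_1,\dots,c_r$; the $\lambda_i$ are the eigenvalues of $x$, uniquely determined with their multiplicities. Put $\operatorname{trace}(x)=\sum_i\lambda_i$ and $\|x\|_\infty=\max_i|\lambda_i|$, and from now on $\langle x,y\rangle=\operatorname{trace}(x\circ y)$. Let $Q_v(x)=2\,v\circ(v\circ x)-v^2\circ x$. An element $y$ is the inverse $x^{-1}$ of $x$ if $x\circ y=e$ and $x^2\circ y=x$.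 Let $c_1,\dots,c_r$ be a Jordan frame of $\mathbb{E}$, $H\subseteq\{1,\dots,r\}$ a nonempty set, $0<\xi<1$, and $$g=\sqrt{\xi}\sum_{h\in H}c_h+\sum_{h\notin H}c_h .$$ Then $g\in\operatorname{int}\mathcal{K}$, $g^{-1}=\frac{1}{\sqrt{\xi}}\sum_{h\in H}c_h+\sum_{h\notin H}c_h$, and $$Q_g\bigl(\{\bar x\in\operatorname{int}\mathcal{K} : \|\bar x\|_\infty\le 1\}\bigr)\subseteq\{x\in\operatorname{int}\mathcal{K} : \|x\|_\infty\le 1,\ \langle c_i,x\rangle\le\xi\ (i\in H),\ \langle c_i,x\rangle\le 1\ (i\notin H)\}.$$ -/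

import Mathlib

/-- A Euclidean Jordan algebra: a finite-dimensional real inner product space with a commutative
bilinear product `*` (written `∘` in the literature), an identity element `1` (written `e`), the
Jordan identity, and an inner product for which multiplication operators are symmetric. -/
class EuclideanJordanAlgebra (E : Type*) extends
    NormedAddCommGroup E, NonAssocCommRing E, InnerProductSpace ℝ E where
  protected finiteDimensional : FiniteDimensional ℝ E
  protected smul_mul : ∀ (a : ℝ) (x y : E), (a • x) * y = a • (x * y)
  protected jordan : ∀ x y : E, x * ((x * x) * y) = (x * x) * (x * y)
  protected inner_mul : ∀ x y z : E, inner (x * y) z = inner y (x * z)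

namespace EuclideanJordanAlgebra

variable {E : Type*} [EuclideanJordanAlgebra E]

instance : FiniteDimensional ℝ E := EuclideanJordanAlgebra.finiteDimensional

instance : IsScalarTower ℝ E E := ⟨EuclideanJordanAlgebra.smul_mul⟩

instance : SMulCommClass ℝ E E :=
  ⟨fun a x y => by
    rw [smul_eq_mul, smul_eq_mul, mul_comm x (a • y), EuclideanJordanAlgebra.smul_mul,
      mul_comm y x]⟩

instance : IsCommJordan E :=
  ⟨fun x y => by
    rw [mul_comm (x * y) (x * x), ← EuclideanJordanAlgebra.jordan, mul_comm y (x * x)]⟩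

/-- A primitive idempotent: a nonzero idempotent that is not the sum of two nonzero idempotents. -/
def IsPrimitiveIdempotent (c : E) : Prop :=
  c ≠ 0 ∧ c * c = c ∧
    ∀ a b : E, a * a = a → b * b = b → a + b = c → a = 0 ∨ b = 0

/-- A Jordan frame: pairwise orthogonal primitive idempotents that sum to the identity. -/
structure IsJordanFrame {n : ℕ} (c : Fin n → E) : Prop where
  primitive : ∀ i, IsPrimitiveIdempotent (c i)
  orthogonal : ∀ i j, i ≠ j → c i * c j = 0
  sum_eq_one : ∑ i, c i = 1

/-- The multiset `s` is the list of coefficients, with multiplicity, of an expansion of `x` in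
some Jordan frame. -/
def HasEigenvalues (x : E) (s : Multiset ℝ) : Prop :=
  ∃ (n : ℕ) (c : Fin n → E) (l : Fin n → ℝ),
    IsJordanFrame c ∧ x = ∑ i, l i • c i ∧ s = Finset.univ.val.map l

open Classical in
/-- The eigenvalues of `x`, with multiplicity. By the spectral theorem there is exactly one `s`
with `HasEigenvalues x s`, so the choice is no choice and the default value is never taken. -/
noncomputable def eigenvalues (x : E) : Multiset ℝ :=
  if h : ∃ s, HasEigenvalues x s then h.choose else 0

/-- The trace: the sum of the eigenvalues. -/
noncomputable def trace (x : E) : ℝ := (eigenvalues x).sum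

/-- The trace inner product `⟨x, y⟩ = trace (x ∘ y)`. -/
noncomputable def traceInner (x y : E) : ℝ := trace (x * y)

/-- The spectral norm `‖x‖_∞`: the largest absolute value of an eigenvalue. -/
noncomputable def specNorm (x : E) : ℝ := sSup {t : ℝ | ∃ a ∈ eigenvalues x, t = |a|}

variable (E) in
/-- The symmetric cone of `E`: the set of squares. -/
def cone : Set E := {y | ∃ x : E, y = x * x}

/-- The quadratic representation `Q_v x = 2 v ∘ (v ∘ x) - v² ∘ x`. -/
def quadRep (v x : E) : E := (2 : ℝ) • (v * (v * x)) - (v * v) * x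

/-- `y` is the inverse of `x` in the Jordan algebra. (The second equation, which is part of the
usual definition, makes `y` unique.) -/
def IsInverse (x y : E) : Prop := x * y = 1 ∧ (x * x) * y = x

variable (E) in
/-- The points of the interior of the cone of spectral norm at most one. -/
def scaledRegion : Set E := {x | x ∈ interior (cone E) ∧ specNorm x ≤ 1}

/-- The part of that region cut out by the bounds `ξ` (on `H`) and `1` (off `H`) for the
components along the frame `c`. -/
def cutRegion {r : ℕ} (c : Fin r → E) (H : Finset (Fin r)) (ξ : ℝ) : Set E :=
  {x | x ∈ interior (cone E) ∧ specNorm x ≤ 1 ∧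
    (∀ i ∈ H, traceInner (c i) x ≤ ξ) ∧ (∀ i ∉ H, traceInner (c i) x ≤ 1)}

/-- The scaling point with coefficient `t` on `H` and `1` off `H`. -/
def scalingPoint {r : ℕ} (c : Fin r → E) (H : Finset (Fin r)) (t : ℝ) : E :=
  t • ∑ h ∈ H, c h + ∑ h ∈ Hᶜ, c h

end EuclideanJordanAlgebra

/-! With `p = ∑ h ∈ H, c h` and `t = √ξ`, one has `g = t p + (1 - p)`, and `Q_g` acts on the Peirce
spaces `E_1(p)`, `E_{1/2}(p)`, `E_0(p)` as `t²`, `t`, `1`. The key point is that `Q_g` preserves the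
cone (`quadRep_mem_cone`). For primitive `d`, `Q_d` has rank one, so `(Q_g d)² = Q_g Q_d g² = m Q_g
d` with `m ≥ 0`, which makes `Q_g d` zero or a positive multiple of a square; the spectral theorem
extends this to the cone. The norm bound is `1 - Q_g x = Q_g (1 - x) + (1 - t²) p`. The trace bounds
move `Q_g` onto `c i`, which it scales by `t²` or `1`. The given inner product need not be the trace
form, but `traceInner c x = ⟪c, x⟫ / ⟪c, c⟫` for primitive `c`. -/

namespace EuclideanJordanAlgebra

/-! ### Linearized Jordan identity and Peirce decomposition. -/

section Product

variable {E : Type*} [EuclideanJordanAlgebra E]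

theorem inner_mul_left (x y z : E) : inner ℝ (x * y) z = inner ℝ y (x * z) :=
  EuclideanJordanAlgebra.inner_mul x y z

theorem jordan_linearized (a b c d : E) :
    a * ((b * c) * d) + b * ((c * a) * d) + c * ((a * b) * d) =
      (b * c) * (a * d) + (c * a) * (b * d) + (a * b) * (c * d) := by
  have h : (2 : ℕ) • ((a * ((b * c) * d) - (b * c) * (a * d)) +
      (b * ((c * a) * d) - (c * a) * (b * d)) + (c * ((a * b) * d) - (a * b) * (c * d))) = 0 :=
    DFunLike.congr_fun (two_nsmul_lie_lmul_lmul_add_add_eq_zero a b c) d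
  have h2 : (2 : ℝ) • (a * ((b * c) * d) + b * ((c * a) * d) + c * ((a * b) * d) -
      ((b * c) * (a * d) + (c * a) * (b * d) + (a * b) * (c * d))) = 0 := by
    linear_combination (norm := module) h
  exact sub_eq_zero.1 ((smul_eq_zero.1 h2).resolve_left two_ne_zero)

/-- The operator identity `L_{a²b} = L_{a²} L_b + 2 L_{ab} L_a - 2 L_a L_b L_a`. -/
theorem sq_mul_mul (a b d : E) :
    ((a * a) * b) * d =
      (a * a) * (b * d) + (2 : ℝ) • ((a * b) * (a * d)) - (2 : ℝ) • (a * (b * (a * d))) := by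
  have h := jordan_linearized a a d b
  rw [mul_comm d a, mul_comm (a * d) b, mul_comm d (a * a * b), mul_comm (a * d) (a * b),
    mul_comm d b] at h
  linear_combination (norm := module) h

/-- Multiplication by an element of `E_1(c)` or `E_0(c)` commutes with multiplication by `c`. -/
theorem mul_left_comm_of_idempotent {c x : E} (hc : c * c = c) {t : ℝ} (hx : c * x = t • x)
    (ht : t ≠ 1 / 2) (z : E) : c * (x * z) = x * (c * z) := by
  have h := jordan_linearized c c x z
  rw [mul_comm x c, hx, hc] at h
  simp only [smul_mul_assoc, mul_smul_comm] at h
  have h2 : (2 * t - 1) • (c * (x * z) - x * (c * z)) = 0 := by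
    linear_combination (norm := module) h
  refine sub_eq_zero.1 ((smul_eq_zero.1 h2).resolve_left fun h3 => ht (by linarith))

theorem peirce_one_comm {c x : E} (hc : c * c = c) (hx : c * x = x) (z : E) :
    c * (x * z) = x * (c * z) :=
  mul_left_comm_of_idempotent hc (t := 1) (by rw [hx, one_smul]) (by norm_num) z

theorem peirce_zero_comm {c x : E} (hc : c * c = c) (hx : c * x = 0) (z : E) :
    c * (x * z) = x * (c * z) :=
  mul_left_comm_of_idempotent hc (t := 0) (by rw [hx, zero_smul]) (by norm_num) z

/-- Commuting `c` past `x` gives `c (x y) = 0`; commuting it past `y` gives `c (x y) = x y`. -/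
theorem peirce_one_mul_zero {c x y : E} (hc : c * c = c) (hx : c * x = x) (hy : c * y = 0) :
    x * y = 0 := by
  have h1 := peirce_one_comm hc hx y
  have h2 := peirce_zero_comm hc hy x
  rw [hy, mul_zero] at h1
  rw [hx, mul_comm y x, h1] at h2
  exact h2.symm

/-- Thus `z²` has no component in `E_{1/2}(c)`, and its `E_1(c)` component is `c z²`. -/
theorem peirce_half_sq {c z : E} (hc : c * c = c) (hz : c * z = (1 / 2 : ℝ) • z) :
    c * (c * (z * z)) = c * (z * z) := by
  have h := jordan_linearized c z z c
  rw [hc, mul_comm z c, hz] at h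
  simp only [smul_mul_assoc, mul_smul_comm, mul_comm z c, hz, mul_comm (z * z) c] at h
  linear_combination (norm := module) h

/-- The minimal polynomial relation `2L³ - 3L² + L = 0` for multiplication by an idempotent. -/
theorem idempotent_cubic {c : E} (hc : c * c = c) (z : E) :
    (2 : ℝ) • (c * (c * (c * z))) = (3 : ℝ) • (c * (c * z)) - c * z := by
  have h := sq_mul_mul c c z
  rw [hc, hc] at h
  linear_combination (norm := module) h

/-- The Peirce decomposition with respect to an idempotent. -/
theorem exists_peirce {c : E} (hc : c * c = c) (x : E) :
    ∃ x1 xh x0 : E, x = x1 + xh + x0 ∧ c * x1 = x1 ∧ c * xh = (1 / 2 : ℝ) • xh ∧ c * x0 = 0 := by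
  have h := idempotent_cubic hc x
  -- The Lagrange interpolation polynomials in `L_c` at the nodes `1`, `1/2`, `0`.
  refine ⟨(2 : ℝ) • (c * (c * x)) - c * x, (4 : ℝ) • (c * x) - (4 : ℝ) • (c * (c * x)),
    x - (3 : ℝ) • (c * x) + (2 : ℝ) • (c * (c * x)), by module, ?_, ?_, ?_⟩ <;>
  simp only [mul_add, mul_sub, mul_smul_comm]
  · linear_combination (norm := module) h
  · linear_combination (norm := module) (-2 : ℝ) • h
  · linear_combination (norm := module) h

theorem inner_idempotent_mul_nonneg {c : E} (hc : c * c = c) (x : E) :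
    0 ≤ inner ℝ x (c * x) := by
  obtain ⟨x1, xh, x0, rfl, h1, hh, h0⟩ := exists_peirce hc x
  have e1 : c * (x1 + xh + x0) = x1 + (1 / 2 : ℝ) • xh := by
    rw [mul_add, mul_add, h1, hh, h0, add_zero]
  have o1 : inner ℝ x1 xh = (0 : ℝ) := by
    have := inner_mul_left c x1 xh
    rw [h1, hh, inner_smul_right] at this
    linarith
  have o2 : inner ℝ x0 x1 = (0 : ℝ) := by
    have := inner_mul_left c x0 x1
    rw [h1, h0, inner_zero_left] at this
    linarith
  have o3 : inner ℝ x0 xh = (0 : ℝ) := by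
    have := inner_mul_left c x0 xh
    rw [hh, h0, inner_zero_left, inner_smul_right] at this
    linarith
  rw [e1]
  simp only [inner_add_left, inner_add_right, inner_smul_right, o1, o2, o3,
    real_inner_comm x1 xh]
  have := real_inner_self_nonneg (x := x1)
  have := real_inner_self_nonneg (x := xh)
  linarith

end Product

/-! ### Spectral theorem and Jordan frames. -/

section Spectral

variable {E : Type*} [EuclideanJordanAlgebra E]

/-- Multiplication operators as linear maps. -/
def lmul (x : E) : E →ₗ[ℝ] E := LinearMap.mulLeft ℝ x

theorem lmul_apply (x y : E) : lmul x y = x * y := rfl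

theorem lmul_isSymmetric (x : E) : (lmul x).IsSymmetric := fun y z => by
  simpa only [lmul_apply] using inner_mul_left x y z

theorem sq_mul_pow (x : E) (n : ℕ) :
    (x * x) * ((lmul x ^ n) 1) = (lmul x ^ (n + 2)) 1 := by
  induction n with
  | zero => simp [pow_succ, lmul_apply]
  | succ n ih =>
    rw [pow_succ' (lmul x) n, pow_succ' (lmul x) (n + 2), Module.End.mul_apply,
      Module.End.mul_apply, lmul_apply, lmul_apply, ← ih, EuclideanJordanAlgebra.jordan]

/-- Since `xⁿ⁺² = x² xⁿ`, `sq_mul_mul` expresses its multiplication operator through those of `x²`,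
`xⁿ`, `xⁿ⁺¹` and `x`, all of which commute with `L_x`. -/
theorem pow_mul_left_comm (x : E) (n : ℕ) (z : E) :
    ((lmul x ^ n) 1) * (x * z) = x * ((lmul x ^ n) 1 * z) := by
  induction n using Nat.strong_induction_on generalizing z with
  | _ n ih =>
    match n with
    | 0 => simp
    | 1 => simp [lmul_apply]
    | n + 2 =>
      have h0 := ih n (by omega)
      have h1 := ih (n + 1) (by omega)
      rw [pow_succ' (lmul x) n, Module.End.mul_apply, lmul_apply] at h1
      rw [← sq_mul_pow, sq_mul_mul, sq_mul_mul]
      simp only [mul_add, mul_sub, mul_smul_comm]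
      simp only [h0, h1, ← EuclideanJordanAlgebra.jordan x]

/-- The elements `a` all of whose iterates `Lₓⁿ a` operator-commute with `x`. -/
def commIterates (x : E) : Submodule ℝ E where
  carrier := {a | ∀ (n : ℕ) (z : E), ((lmul x ^ n) a) * (x * z) = x * ((lmul x ^ n) a * z)}
  add_mem' := fun {a b} ha hb n z => by
    rw [map_add, add_mul, add_mul, mul_add, ha n z, hb n z]
  zero_mem' := fun n z => by simp
  smul_mem' := fun t a ha n z => by
    rw [map_smul, smul_mul_assoc, smul_mul_assoc, mul_smul_comm, ha n z]

theorem lmul_mem_commIterates {x a : E} (ha : a ∈ commIterates x) :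
    lmul x a ∈ commIterates x := fun n z => by
  have := ha (n + 1) z
  rwa [pow_succ, Module.End.mul_apply] at this

theorem iSup_eigenspace_lmul (x : E) : ⨆ μ, Module.End.eigenspace (lmul x) μ = ⊤ := by
  rw [← Submodule.orthogonal_eq_bot_iff]
  exact (lmul_isSymmetric x).orthogonalComplement_iSup_eigenspaces_eq_bot

/-- The `d μ` are the components of `1` in the eigenspaces of the symmetric operator `L_x`. As
`commIterates x` is `L_x`-invariant and contains `1`, it contains these components, so they
operator-commute with `x`. This forces orthogonality, and multiplying `∑ d ν = 1` by `d μ` gives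
idempotence. -/
theorem exists_eigen_idempotents (x : E) :
    ∃ (s : Finset ℝ) (d : ℝ → E), (∀ μ, d μ * d μ = d μ) ∧
      (∀ μ ν, μ ≠ ν → d μ * d ν = 0) ∧ ∑ μ ∈ s, d μ = 1 ∧ (∀ μ, x * d μ = μ • d μ) ∧
      ∀ μ z, d μ * (x * z) = x * (d μ * z) := by
  have hW : (1 : E) ∈ ⨆ μ, commIterates x ⊓ Module.End.eigenspace (lmul x) μ := by
    have h := Submodule.eq_iSup_inf_genEigenspace (p := commIterates x) (f := lmul x) 1
      (fun a ha => lmul_mem_commIterates ha) (iSup_eigenspace_lmul x)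
    have h1 : (1 : E) ∈ commIterates x := pow_mul_left_comm x
    rw [h] at h1
    exact h1
  obtain ⟨f, hf, hsum⟩ := (Submodule.mem_iSup_iff_exists_finsupp _ _).1 hW
  have hx : ∀ μ, x * f μ = μ • f μ := fun μ => Module.End.mem_eigenspace_iff.1 (hf μ).2
  have hcomm : ∀ μ z, f μ * (x * z) = x * (f μ * z) := fun μ z => (hf μ).1 0 z
  have horth : ∀ μ ν, μ ≠ ν → f μ * f ν = 0 := by
    intro μ ν hne
    have h1 := hcomm μ (f ν)
    have h2 := hcomm ν (f μ)
    rw [hx, mul_smul_comm] at h1 h2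
    rw [mul_comm (f ν), ← h1, ← sub_eq_zero, ← sub_smul] at h2
    exact (smul_eq_zero.1 h2).resolve_left (sub_ne_zero.2 hne)
  have hsum' : ∑ μ ∈ f.support, f μ = 1 := hsum
  refine ⟨f.support, f, fun μ => ?_, horth, hsum', hx, hcomm⟩
  have h : f μ * ∑ ν ∈ f.support, f ν = f μ * f μ := by
    rw [Finset.mul_sum]
    refine Finset.sum_eq_single μ (fun ν _ hne => horth μ ν hne.symm) fun h => ?_
    rw [Finsupp.notMem_support_iff.1 h, mul_zero]
  rw [← h, hsum', mul_one]

/-- For a primitive idempotent, the Peirce space `E_1(c)` is the line through `c`. -/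
theorem IsPrimitiveIdempotent.exists_smul_eq {c y : E} (hc : IsPrimitiveIdempotent c)
    (hy : c * y = y) : ∃ t : ℝ, y = t • c := by
  obtain ⟨hc0, hcc, hprim⟩ := hc
  obtain ⟨s, d, hd, horth, hsum, hyd, hcomm⟩ := exists_eigen_idempotents y
  -- As `c` and `y` operator-commute, `μ d μ = (c y) d μ = c (y d μ) = μ (c d μ)`. Then `c = d μ +
  -- (c - d μ)` contradicts primitivity unless one summand vanishes.
  have hcd : ∀ μ, μ ≠ 0 → c * d μ = d μ := by
    intro μ hμ
    have h1 := hcomm μ c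
    rw [mul_comm y c, hy, mul_comm (d μ) y, hyd, mul_comm (d μ) c,
      ← peirce_one_comm hcc hy, hyd, mul_smul_comm] at h1
    exact (smul_right_injective E hμ h1).symm
  have hzero : ∀ μ, μ ≠ 0 → d μ = 0 ∨ d μ = c := by
    intro μ hμ
    refine (hprim (d μ) (c - d μ) (hd μ) ?_ (by abel)).imp id fun h => (sub_eq_zero.1 h).symm
    rw [sub_mul, mul_sub, mul_sub, hcc, hd, mul_comm (d μ) c, hcd μ hμ]
    abel
  have hyexp : y = ∑ μ ∈ s, μ • d μ := by
    rw [← Finset.sum_congr rfl fun μ _ => hyd μ, ← Finset.mul_sum, hsum, mul_one]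
  by_cases h : ∃ μ, μ ≠ 0 ∧ d μ = c
  · obtain ⟨μ, -, hμc⟩ := h
    refine ⟨μ, ?_⟩
    have h1 : c * y = μ • c := by rw [mul_comm, ← hμc, hyd]
    rw [← hy, h1]
  · push Not at h
    refine ⟨0, ?_⟩
    rw [hyexp, zero_smul]
    refine Finset.sum_eq_zero fun μ _ => ?_
    by_cases hμ : μ = 0
    · rw [hμ, zero_smul]
    · rw [(hzero μ hμ).resolve_right (h μ hμ), smul_zero]

/-- An expansion of `x` in a complete system of `n` nonzero orthogonal idempotents. -/
def HasExpansion (x : E) (n : ℕ) : Prop :=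
  ∃ (d : Fin n → E) (l : Fin n → ℝ), (∀ i, d i ≠ 0) ∧ (∀ i, d i * d i = d i) ∧
    (∀ i j, i ≠ j → d i * d j = 0) ∧ ∑ i, d i = 1 ∧ x = ∑ i, l i • d i

theorem inner_eq_zero_of_mul_eq_zero {a b : E} (h : a * b = 0) : inner ℝ a b = 0 := by
  have := inner_mul_left a 1 b
  rwa [mul_one, h, inner_zero_right] at this

theorem HasExpansion.le_finrank {x : E} {n : ℕ} (h : HasExpansion x n) :
    n ≤ Module.finrank ℝ E := by
  obtain ⟨d, l, h0, -, horth, -, -⟩ := h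
  have hli : LinearIndependent ℝ d :=
    linearIndependent_of_ne_zero_of_inner_eq_zero h0 fun i j hij =>
      inner_eq_zero_of_mul_eq_zero (horth i j hij)
  simpa using hli.fintype_card_le_finrank

theorem exists_hasExpansion (x : E) : ∃ n, HasExpansion x n := by
  classical
  obtain ⟨s, d, hd, horth, hsum, hxd, -⟩ := exists_eigen_idempotents x
  have hx : x = ∑ μ ∈ s, μ • d μ := by
    rw [← Finset.sum_congr rfl fun μ _ => hxd μ, ← Finset.mul_sum, hsum, mul_one]
  let s' := s.filter fun μ => d μ ≠ 0
  let e := s'.equivFin.symm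
  refine ⟨s'.card, fun i => d (e i), fun i => (e i : ℝ),
    fun i => (Finset.mem_filter.1 (e i).2).2, fun i => hd _, fun i j hij => horth _ _ ?_, ?_, ?_⟩
  · exact fun h => hij (e.injective (Subtype.ext h))
  · rw [e.sum_comp (fun μ : s' => d μ), Finset.sum_coe_sort s' d, Finset.sum_filter_ne_zero, hsum]
  · rw [e.sum_comp (fun μ : s' => (μ : ℝ) • d μ), Finset.sum_coe_sort s' fun μ => μ • d μ, hx]
    refine (Finset.sum_subset (Finset.filter_subset _ _) fun μ hμ hμ' => ?_).symm
    have : d μ = 0 := by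
      by_contra h
      exact hμ' (Finset.mem_filter.2 ⟨hμ, h⟩)
    rw [this, smul_zero]

theorem mul_eq_zero_of_add_idempotent {a b : E} (ha : a * a = a) (hb : b * b = b)
    (hab : (a + b) * (a + b) = a + b) : a * b = 0 := by
  rw [add_mul, mul_add, mul_add, ha, hb, mul_comm b a] at hab
  have h : (2 : ℝ) • (a * b) = 0 := by linear_combination (norm := module) hab
  exact (smul_eq_zero.1 h).resolve_left two_ne_zero

/-- Nonzero orthogonal idempotents are linearly independent, so a longest expansion exists; a
non-primitive member could be split to give a longer one. -/
theorem exists_frame_expansion (x : E) :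
    ∃ (n : ℕ) (c : Fin n → E) (l : Fin n → ℝ), IsJordanFrame c ∧ x = ∑ i, l i • c i := by
  classical
  obtain ⟨m, hm⟩ := exists_hasExpansion x
  let n := Nat.findGreatest (HasExpansion x) (Module.finrank ℝ E)
  have hn : HasExpansion x n := Nat.findGreatest_spec hm.le_finrank hm
  have hmax : ¬ HasExpansion x (n + 1) := fun h =>
    absurd (Nat.le_findGreatest h.le_finrank h) (Nat.not_succ_le_self n)
  obtain ⟨d, l, h0, hd, horth, hsum, hx⟩ := hn
  refine ⟨n, d, l, ⟨fun i => ⟨h0 i, hd i, fun a b ha hb hab => ?_⟩, horth, hsum⟩, hx⟩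
  by_contra! hne
  have hab0 : a * b = 0 := mul_eq_zero_of_add_idempotent ha hb (by rw [hab, hd])
  have hda : d i * a = a := by rw [← hab, add_mul, ha, mul_comm b, hab0, add_zero]
  have hdb : d i * b = b := by rw [← hab, add_mul, hb, hab0, zero_add]
  have haj : ∀ j, j ≠ i → a * d j = 0 := fun j hj =>
    peirce_one_mul_zero (hd i) hda (horth i j hj.symm)
  have hbj : ∀ j, j ≠ i → b * d j = 0 := fun j hj =>
    peirce_one_mul_zero (hd i) hdb (horth i j hj.symm)
  -- `b` replaces `d i` and `a` is prepended, both with coefficient `l i`.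
  refine hmax ⟨Fin.cons a (Function.update d i b), Fin.cons (l i) l, ?_, ?_, ?_, ?_, ?_⟩
  · refine Fin.cases hne.1 fun j => ?_
    by_cases hj : j = i
    · subst hj; simpa using hne.2
    · simpa [hj] using h0 j
  · refine Fin.cases ha fun j => ?_
    by_cases hj : j = i
    · subst hj; simpa using hb
    · simpa [hj] using hd j
  · refine Fin.cases (Fin.cases (by simp) fun k _ => ?_)
      fun j => Fin.cases (fun _ => ?_) fun k hjk => ?_
    · by_cases hk : k = i
      · subst hk; simpa using hab0
      · simpa [hk] using haj k hk
    · by_cases hj : j = i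
      · subst hj; simpa [mul_comm b] using hab0
      · simpa [hj, mul_comm _ a] using haj j hj
    · have hjk' : j ≠ k := fun h => hjk (by rw [h])
      by_cases hj : j = i
      · subst hj
        simpa [hjk'.symm] using hbj k hjk'.symm
      · by_cases hk : k = i
        · subst hk
          simpa [hj, mul_comm _ b] using hbj j hj
        · simpa [hj, hk] using horth j k hjk'
  · rw [Fin.sum_univ_succ]
    simp only [Fin.cons_zero, Fin.cons_succ]
    rw [Finset.sum_update_of_mem (Finset.mem_univ i), ← add_assoc, hab, ← hsum,
      ← Finset.erase_eq, Finset.add_sum_erase _ _ (Finset.mem_univ i)]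
  · rw [Fin.sum_univ_succ]
    simp only [Fin.cons_zero, Fin.cons_succ]
    rw [hx, ← Finset.add_sum_erase _ _ (Finset.mem_univ i),
      ← Finset.add_sum_erase Finset.univ (fun j => l j • Function.update d i b j)
        (Finset.mem_univ i), Function.update_self, ← add_assoc, ← smul_add, hab]
    congr 1
    refine Finset.sum_congr rfl fun j hj => ?_
    rw [Function.update_of_ne (Finset.ne_of_mem_erase hj)]

end Spectral
-- Self-duality and interior of the cone.
section Cone

variable {E : Type*} [EuclideanJordanAlgebra E]

theorem IsJordanFrame.idempotent {n : ℕ} {c : Fin n → E} (hc : IsJordanFrame c) (i : Fin n) :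
    c i * c i = c i := (hc.primitive i).2.1

theorem IsJordanFrame.sum_mul {n : ℕ} {c : Fin n → E} (hc : IsJordanFrame c) (l : Fin n → ℝ)
    (i : Fin n) : (∑ j, l j • c j) * c i = l i • c i := by
  rw [Finset.sum_mul, Finset.sum_eq_single i]
  · rw [smul_mul_assoc, hc.idempotent]
  · intro j _ hj
    rw [smul_mul_assoc, hc.orthogonal j i hj, smul_zero]
  · exact fun h => absurd (Finset.mem_univ i) h

theorem inner_idempotent_eq {d : E} (hd : d * d = d) (x : E) :
    inner ℝ d (x * d) = inner ℝ d x := by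
  rw [mul_comm x d, ← inner_mul_left, hd]

theorem inner_idempotent_nonneg_of_mem_cone {d x : E} (hd : d * d = d) (hx : x ∈ cone E) :
    0 ≤ inner ℝ d x := by
  obtain ⟨y, rfl⟩ := hx
  rw [← inner_mul_left, mul_comm, real_inner_comm]
  exact inner_idempotent_mul_nonneg hd y

theorem eq_zero_of_mul_self_eq_zero {x : E} (h : x * x = 0) : x = 0 :=
  inner_self_eq_zero.1 (inner_eq_zero_of_mul_eq_zero h)

theorem mem_cone_of_frame {n : ℕ} {c : Fin n → E} (hc : IsJordanFrame c) {l : Fin n → ℝ}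
    (hl : ∀ i, 0 ≤ l i) : ∑ i, l i • c i ∈ cone E := by
  refine ⟨∑ i, √(l i) • c i, ?_⟩
  rw [Finset.mul_sum]
  refine Finset.sum_congr rfl fun i _ => ?_
  rw [mul_smul_comm, hc.sum_mul, smul_smul, Real.mul_self_sqrt (hl i)]

theorem IsJordanFrame.coeff_nonneg {n : ℕ} {c : Fin n → E} (hc : IsJordanFrame c)
    {l : Fin n → ℝ} (i : Fin n) (h : 0 ≤ inner ℝ (c i) (∑ j, l j • c j)) : 0 ≤ l i := by
  rw [← inner_idempotent_eq (hc.idempotent i), hc.sum_mul, inner_smul_right] at h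
  exact nonneg_of_mul_nonneg_left h (real_inner_self_pos.2 (hc.primitive i).1)

/-- The symmetric cone is the dual of the set of idempotents. -/
theorem mem_cone_iff {x : E} : x ∈ cone E ↔ ∀ d : E, d * d = d → 0 ≤ inner ℝ d x := by
  refine ⟨fun hx d hd => inner_idempotent_nonneg_of_mem_cone hd hx, fun h => ?_⟩
  obtain ⟨n, c, l, hc, rfl⟩ := exists_frame_expansion x
  exact mem_cone_of_frame hc fun i => hc.coeff_nonneg i (h _ (hc.idempotent i))

theorem IsJordanFrame.coeff_nonneg_of_mem_cone {n : ℕ} {c : Fin n → E} (hc : IsJordanFrame c)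
    {l : Fin n → ℝ} (h : ∑ j, l j • c j ∈ cone E) (i : Fin n) : 0 ≤ l i :=
  hc.coeff_nonneg i (mem_cone_iff.1 h _ (hc.idempotent i))

theorem add_mem_cone {x y : E} (hx : x ∈ cone E) (hy : y ∈ cone E) : x + y ∈ cone E :=
  mem_cone_iff.2 fun d hd => by
    rw [inner_add_right]
    exact add_nonneg (mem_cone_iff.1 hx d hd) (mem_cone_iff.1 hy d hd)

theorem smul_mem_cone {t : ℝ} (ht : 0 ≤ t) {x : E} (hx : x ∈ cone E) : t • x ∈ cone E :=
  mem_cone_iff.2 fun d hd => by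
    rw [inner_smul_right]
    exact mul_nonneg ht (mem_cone_iff.1 hx d hd)

theorem idempotent_mem_cone {d : E} (hd : d * d = d) : d ∈ cone E := ⟨d, hd.symm⟩

theorem sum_mem_cone {ι : Type*} (s : Finset ι) {f : ι → E} (hf : ∀ i ∈ s, f i ∈ cone E) :
    ∑ i ∈ s, f i ∈ cone E :=
  Finset.sum_induction _ (· ∈ cone E) (fun _ _ => add_mem_cone)
    (idempotent_mem_cone (mul_zero 0)) hf

theorem one_mem_interior_cone : (1 : E) ∈ interior (cone E) := by
  let L : E →ₗ[ℝ] E →L[ℝ] E :=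
    LinearMap.toContinuousLinearMap.toLinearMap ∘ₗ LinearMap.mul ℝ E
  have hL : Continuous L := L.continuous_of_finiteDimensional
  have hcont : Continuous fun z : E => ‖L (z - 1)‖ := by fun_prop
  -- Frame elements of `z` are eigenvectors of `L_{z-1}` with eigenvalues `l i - 1`, bounded by the
  -- operator norm.
  refine mem_interior.2 ⟨{z | ‖L (z - 1)‖ < 1}, fun z hz => ?_,
    isOpen_lt hcont continuous_const, by simp⟩
  obtain ⟨n, c, l, hc, hzl⟩ := exists_frame_expansion z
  rw [hzl]
  refine mem_cone_of_frame hc fun i => ?_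
  have h1 : L (z - 1) (c i) = (l i - 1) • c i := by
    change (z - 1) * c i = _
    rw [sub_mul, one_mul, hzl, hc.sum_mul, sub_smul, one_smul]
  have h2 := (L (z - 1)).le_opNorm (c i)
  rw [h1, norm_smul] at h2
  have h3 := le_of_mul_le_mul_right h2 (norm_pos_iff.2 (hc.primitive i).1)
  have h4 := h3.trans hz.le
  rw [Real.norm_eq_abs] at h4
  linarith [neg_le_of_abs_le h4]

end Cone

/-! ### Rank one quadratic representations, trace form and spectral norm. -/

section QuadRep

variable {E : Type*} [EuclideanJordanAlgebra E]

/-- The quadratic representation as a linear map. -/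
def quadRepLin (v : E) : E →ₗ[ℝ] E := (2 : ℝ) • (lmul v ∘ₗ lmul v) - lmul (v * v)

theorem quadRepLin_apply (v x : E) : quadRepLin v x = quadRep v x := rfl

theorem inner_quadRep (v x y : E) : inner ℝ (quadRep v x) y = inner ℝ x (quadRep v y) := by
  simp only [quadRep, inner_sub_left, inner_sub_right, inner_smul_left, inner_smul_right,
    inner_mul_left, RCLike.conj_to_real]

theorem inner_quadRep_idempotent {c d : E} (hc : c * c = c) :
    inner ℝ (quadRep c d) d = 2 * inner ℝ (c * d) (c * d) - inner ℝ (c * d) d := by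
  simp only [quadRep, inner_sub_left, inner_smul_left, hc, RCLike.conj_to_real]
  rw [inner_mul_left c (c * d) d]

theorem mul_quadRep_idempotent {c : E} (hc : c * c = c) (x : E) :
    c * quadRep c x = quadRep c x := by
  have h := idempotent_cubic hc x
  simp only [quadRep, mul_sub, mul_smul_comm, hc]
  linear_combination (norm := module) h

/-- The quadratic representation of a primitive idempotent is a rank one projection. -/
theorem IsPrimitiveIdempotent.quadRep_eq {c : E} (hc : IsPrimitiveIdempotent c) (x : E) :
    quadRep c x = (inner ℝ c x / inner ℝ c c) • c := by
  obtain ⟨t, ht⟩ := hc.exists_smul_eq (mul_quadRep_idempotent hc.2.1 x)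
  have h := inner_quadRep c c x
  have hcc : quadRep c c = c := by
    rw [quadRep, hc.2.1, hc.2.1, two_smul, add_sub_cancel_right]
  rw [ht, hcc, inner_smul_right] at h
  rw [ht, h, mul_div_cancel_right₀ _ (real_inner_self_pos.2 hc.1).ne']

/-- Two primitive idempotents are orthogonal or have the same length. -/
theorem IsPrimitiveIdempotent.mul_eq_zero_or_inner_self_eq {c d : E}
    (hc : IsPrimitiveIdempotent c) (hd : IsPrimitiveIdempotent d) :
    c * d = 0 ∨ inner ℝ c c = (inner ℝ d d : ℝ) := by
  -- Both evaluate `2‖c d‖² - ⟪c, d⟫`, which is symmetric in `c` and `d`: once as `⟪c, d⟫² / ⟪c,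
  -- c⟫`, once as `⟪c, d⟫² / ⟪d, d⟫`.
  have h1 := inner_quadRep_idempotent (d := d) hc.2.1
  have h2 := inner_quadRep_idempotent (d := c) hd.2.1
  have e1 : inner ℝ (c * d) d = (inner ℝ c d : ℝ) := by
    rw [mul_comm, inner_mul_left, hd.2.1]
  have e2 : inner ℝ (c * d) c = (inner ℝ c d : ℝ) := by
    rw [inner_mul_left, hc.2.1, real_inner_comm]
  rw [hc.quadRep_eq, inner_smul_left, RCLike.conj_to_real, e1] at h1
  rw [hd.quadRep_eq, inner_smul_left, RCLike.conj_to_real, mul_comm d c, e2,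
    real_inner_comm c d] at h2
  have pc := real_inner_self_pos.2 hc.1
  have pd := real_inner_self_pos.2 hd.1
  by_cases h0 : inner ℝ c d = (0 : ℝ)
  · left
    rw [h0] at h1
    rw [zero_div, MulZeroClass.zero_mul, sub_zero] at h1
    exact (inner_self_eq_zero (𝕜 := ℝ)).1 (by linarith)
  · right
    rw [← h1] at h2
    field_simp at h2
    linarith

/-- Frame elements not orthogonal to `c` share its length, so every coefficient is `⟪c d_j, x⟫ / ⟪c,
c⟫`, and `∑ d_j = 1`. Any expansion works, so uniqueness of eigenvalues is not needed. -/
theorem HasEigenvalues.sum_eq {c x : E} (hc : IsPrimitiveIdempotent c) {s : Multiset ℝ}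
    (h : HasEigenvalues (c * x) s) : s.sum = inner ℝ c x / inner ℝ c c := by
  obtain ⟨n, d, l, hd, hx, rfl⟩ := h
  have hl : ∀ j, l j = inner ℝ (c * d j) x / inner ℝ c c := by
    intro j
    have pd := real_inner_self_pos.2 (hd.primitive j).1
    have h1 : inner ℝ (d j) (c * x) = l j * (inner ℝ (d j) (d j) : ℝ) := by
      rw [← inner_idempotent_eq (hd.idempotent j), hx, hd.sum_mul, inner_smul_right]
    rw [← inner_mul_left] at h1
    rcases hc.mul_eq_zero_or_inner_self_eq (hd.primitive j) with h0 | h0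
    · rw [h0, inner_zero_left] at h1 ⊢
      rw [zero_div]
      exact (mul_eq_zero.1 h1.symm).resolve_right pd.ne'
    · rw [h0, h1, mul_div_cancel_right₀ _ pd.ne']
  change ∑ j, l j = _
  rw [Finset.sum_congr rfl fun j _ => hl j, ← Finset.sum_div, ← sum_inner, ← Finset.mul_sum,
    hd.sum_eq_one, mul_one]

theorem hasEigenvalues_eigenvalues (x : E) : HasEigenvalues x (eigenvalues x) := by
  obtain ⟨n, c, l, hc, hx⟩ := exists_frame_expansion x
  have h : ∃ s, HasEigenvalues x s := ⟨_, n, c, l, hc, hx, rfl⟩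
  rw [eigenvalues, dif_pos h]
  exact h.choose_spec

theorem IsPrimitiveIdempotent.traceInner_eq {c : E} (hc : IsPrimitiveIdempotent c) (x : E) :
    traceInner c x = inner ℝ c x / inner ℝ c c :=
  (hasEigenvalues_eigenvalues (c * x)).sum_eq hc

theorem one_sub_mem_cone_of_specNorm_le {x : E} (h : specNorm x ≤ 1) : 1 - x ∈ cone E := by
  obtain ⟨n, c, l, hc, hx, hs⟩ := hasEigenvalues_eigenvalues x
  have hset : {t : ℝ | ∃ a ∈ eigenvalues x, t = |a|} = Set.range fun i => |l i| := by
    ext t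
    simp [hs, eq_comm]
  have hl : ∀ i, l i ≤ 1 := fun i => by
    rw [specNorm, hset] at h
    exact (le_abs_self _).trans ((le_csSup (Set.finite_range _).bddAbove ⟨i, rfl⟩).trans h)
  have : 1 - x = ∑ i, (1 - l i) • c i := by
    simp only [sub_smul, one_smul, Finset.sum_sub_distrib, hc.sum_eq_one, ← hx]
  rw [this]
  exact mem_cone_of_frame hc fun i => sub_nonneg.2 (hl i)

theorem specNorm_le_one {x : E} (h0 : x ∈ cone E) (h1 : 1 - x ∈ cone E) : specNorm x ≤ 1 := by
  obtain ⟨n, c, l, hc, hx, hs⟩ := hasEigenvalues_eigenvalues x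
  -- `zero_le_one` covers the zero algebra, where the supremum is over the empty set.
  refine Real.sSup_le ?_ zero_le_one
  rintro t ⟨a, ha, rfl⟩
  rw [hs] at ha
  obtain ⟨i, -, rfl⟩ := Multiset.mem_map.1 ha
  have e : 1 - x = ∑ i, (1 - l i) • c i := by
    simp only [sub_smul, one_smul, Finset.sum_sub_distrib, hc.sum_eq_one, ← hx]
  rw [e] at h1
  rw [hx] at h0
  rw [abs_of_nonneg (hc.coeff_nonneg_of_mem_cone h0 i)]
  exact sub_nonneg.1 (hc.coeff_nonneg_of_mem_cone h1 i)

end QuadRep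

/-! ### The scaling map `Q_g` for `g = t p + (1 - p)`. -/

section Scaling

variable {E : Type*} [EuclideanJordanAlgebra E]

/-- Left multiplication by `t p + (1 - p)` on a Peirce decomposition. -/
theorem smul_add_one_sub_mul {p x1 xh x0 : E} (t : ℝ) (h1 : p * x1 = x1)
    (hh : p * xh = (1 / 2 : ℝ) • xh) (h0 : p * x0 = 0) :
    (t • p + (1 - p)) * (x1 + xh + x0) = t • x1 + ((t + 1) / 2) • xh + x0 := by
  simp only [add_mul, sub_mul, smul_mul_assoc, mul_add, one_mul, h1, hh, h0]
  module

theorem smul_add_one_sub_sq {p : E} (hp : p * p = p) (t : ℝ) :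
    (t • p + (1 - p)) * (t • p + (1 - p)) = t ^ 2 • p + (1 - p) := by
  simp only [add_mul, sub_mul, mul_sub, smul_mul_assoc, mul_smul_comm, mul_add, one_mul, mul_one,
    hp]
  module

theorem quadRep_smul_add_one_sub {p x1 xh x0 : E} (hp : p * p = p) (t : ℝ) (h1 : p * x1 = x1)
    (hh : p * xh = (1 / 2 : ℝ) • xh) (h0 : p * x0 = 0) :
    quadRep (t • p + (1 - p)) (x1 + xh + x0) = t ^ 2 • x1 + t • xh + x0 := by
  rw [quadRep, smul_add_one_sub_sq hp, smul_add_one_sub_mul t h1 hh h0,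
    smul_add_one_sub_mul (t ^ 2) h1 hh h0,
    smul_add_one_sub_mul t (by rw [mul_smul_comm, h1])
      (by rw [mul_smul_comm, hh, smul_comm]) h0]
  module

/-- The instance `(Q_g x)² = Q_g Q_x g²` of the fundamental formula for `g = t p + (1 - p)`. -/
theorem quadRep_mul_quadRep {p : E} (hp : p * p = p) (t : ℝ) (x : E) :
    quadRep (t • p + (1 - p)) x * quadRep (t • p + (1 - p)) x =
      quadRep (t • p + (1 - p))
        (quadRep x ((t • p + (1 - p)) * (t • p + (1 - p)))) := by
  obtain ⟨x1, xh, x0, rfl, h1, hh, h0⟩ := exists_peirce hp x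
  have h10 : x1 * x0 = 0 := peirce_one_mul_zero hp h1 h0
  have h11 : p * (x1 * x1) = x1 * x1 := by rw [peirce_one_comm hp h1, h1]
  have h1h : p * (x1 * xh) = (1 / 2 : ℝ) • (x1 * xh) := by
    rw [peirce_one_comm hp h1, hh, mul_smul_comm]
  have h0h : p * (x0 * xh) = (1 / 2 : ℝ) • (x0 * xh) := by
    rw [peirce_zero_comm hp h0, hh, mul_smul_comm]
  have h00 : p * (x0 * x0) = 0 := by rw [peirce_zero_comm hp h0, h0, mul_zero]
  have hu : p * (p * (xh * xh)) = p * (xh * xh) := peirce_half_sq hp hh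
  -- The square is regrouped by Peirce space, with `xh²` split by `peirce_half_sq`.
  have hsq : (x1 + xh + x0) * (x1 + xh + x0) = (x1 * x1 + p * (xh * xh)) +
      ((2 : ℝ) • (x1 * xh) + (2 : ℝ) • (x0 * xh)) + (x0 * x0 + (xh * xh - p * (xh * xh))) := by
    simp only [mul_add, add_mul, h10, mul_comm x0 x1, mul_comm xh x1, mul_comm xh x0]
    module
  have k1 : p * (x1 * x1 + p * (xh * xh)) = x1 * x1 + p * (xh * xh) := by
    rw [mul_add, h11, hu]
  have kh : ∀ a b : ℝ, p * (a • (x1 * xh) + b • (x0 * xh)) =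
      (1 / 2 : ℝ) • (a • (x1 * xh) + b • (x0 * xh)) := fun a b => by
    rw [mul_add, mul_smul_comm, mul_smul_comm, h1h, h0h]
    module
  have k0 : p * (x0 * x0 + (xh * xh - p * (xh * xh))) = 0 := by
    rw [mul_add, mul_sub, h00, hu, sub_self, add_zero]
  have hQ : quadRep (x1 + xh + x0) (t ^ 2 • p + (1 - p)) =
      (t ^ 2 • (x1 * x1) + p * (xh * xh)) +
      ((2 * t ^ 2) • (x1 * xh) + (2 : ℝ) • (x0 * xh)) +
      (x0 * x0 + t ^ 2 • (xh * xh - p * (xh * xh))) := by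
    rw [quadRep, mul_comm (_ * _) (t ^ 2 • p + (1 - p)), hsq,
      mul_comm (x1 + xh + x0) (t ^ 2 • p + (1 - p)), smul_add_one_sub_mul _ h1 hh h0,
      smul_add_one_sub_mul _ k1 (kh _ _) k0]
    simp only [mul_add, add_mul, mul_smul_comm, h10, mul_comm x0 x1, mul_comm xh x1, mul_comm xh x0]
    module
  rw [smul_add_one_sub_sq hp, hQ, quadRep_smul_add_one_sub hp t h1 hh h0,
    quadRep_smul_add_one_sub hp t (by rw [mul_add, mul_smul_comm, h11, hu]) (kh _ _)
      (by rw [mul_add, mul_smul_comm, mul_sub, h00, hu, sub_self, smul_zero, add_zero])]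
  simp only [mul_add, add_mul, smul_mul_assoc, mul_smul_comm, h10, mul_comm x0 x1,
    mul_comm xh x1, mul_comm xh x0]
  module

theorem quadRep_mem_cone {p x : E} (hp : p * p = p) (t : ℝ) (hx : x ∈ cone E) :
    quadRep (t • p + (1 - p)) x ∈ cone E := by
  have hprim : ∀ d : E, IsPrimitiveIdempotent d →
      quadRep (t • p + (1 - p)) d ∈ cone E := by
    intro d hd
    set g := t • p + (1 - p) with hg
    have h := quadRep_mul_quadRep hp t d
    rw [← hg, hd.quadRep_eq, ← quadRepLin_apply g (_ • d), map_smul, quadRepLin_apply] at h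
    -- By rank one `Q_d g² = m d`, so `h` reads `(Q_g d)² = m Q_g d`.
    set m : ℝ := inner ℝ d (g * g) / inner ℝ d d
    have hm : 0 ≤ m := div_nonneg (inner_idempotent_nonneg_of_mem_cone hd.2.1 ⟨g, rfl⟩)
      real_inner_self_nonneg
    rcases hm.eq_or_lt with h0 | h0
    · rw [← h0, zero_smul] at h
      rw [eq_zero_of_mul_self_eq_zero h]
      exact idempotent_mem_cone (mul_zero 0)
    · have : quadRep g d = m⁻¹ • (quadRep g d * quadRep g d) := by
        rw [h, smul_smul, inv_mul_cancel₀ h0.ne', one_smul]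
      rw [this]
      exact smul_mem_cone (inv_nonneg.2 hm) ⟨_, rfl⟩
  obtain ⟨n, c, l, hc, rfl⟩ := exists_frame_expansion x
  rw [← quadRepLin_apply, map_sum]
  refine sum_mem_cone _ fun i _ => ?_
  rw [map_smul]
  exact smul_mem_cone (hc.coeff_nonneg_of_mem_cone hx i) (hprim _ (hc.primitive i))

theorem quadRep_inv_quadRep {p : E} (hp : p * p = p) {s t : ℝ} (hst : s * t = 1) (x : E) :
    quadRep (s • p + (1 - p)) (quadRep (t • p + (1 - p)) x) = x := by
  obtain ⟨x1, xh, x0, rfl, h1, hh, h0⟩ := exists_peirce hp x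
  rw [quadRep_smul_add_one_sub hp t h1 hh h0,
    quadRep_smul_add_one_sub hp s (by rw [mul_smul_comm, h1])
      (by rw [mul_smul_comm, hh, smul_comm]) h0, smul_smul, smul_smul, ← mul_pow, hst, one_pow,
    one_smul, one_smul]

/-- The preimage of the interior under the inverse map, given by `t⁻¹`, is open and lies in the
cone. -/
theorem quadRep_mem_interior_cone {p x : E} (hp : p * p = p) {t : ℝ} (ht : t ≠ 0)
    (hx : x ∈ interior (cone E)) : quadRep (t • p + (1 - p)) x ∈ interior (cone E) := by
  have hcont : Continuous (quadRep (t⁻¹ • p + (1 - p))) :=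
    (quadRepLin (t⁻¹ • p + (1 - p))).continuous_of_finiteDimensional
  refine mem_interior.2 ⟨quadRep (t⁻¹ • p + (1 - p)) ⁻¹' interior (cone E), fun y hy => ?_,
    isOpen_interior.preimage hcont, ?_⟩
  · rw [← quadRep_inv_quadRep hp (mul_inv_cancel₀ ht) y]
    exact quadRep_mem_cone hp t (interior_subset hy)
  · rwa [Set.mem_preimage, quadRep_inv_quadRep hp (inv_mul_cancel₀ ht)]

theorem quadRep_one (v : E) : quadRep v 1 = v * v := by
  rw [quadRep, mul_one, mul_one, two_smul, add_sub_cancel_right]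

theorem IsJordanFrame.sum_mul_of_mem {r : ℕ} {c : Fin r → E} (hc : IsJordanFrame c)
    {H : Finset (Fin r)} {i : Fin r} (hi : i ∈ H) : (∑ h ∈ H, c h) * c i = c i := by
  rw [Finset.sum_mul, Finset.sum_eq_single i (fun j _ hj => hc.orthogonal j i hj)
    (fun h => absurd hi h), hc.idempotent]

theorem IsJordanFrame.sum_mul_of_notMem {r : ℕ} {c : Fin r → E} (hc : IsJordanFrame c)
    {H : Finset (Fin r)} {i : Fin r} (hi : i ∉ H) : (∑ h ∈ H, c h) * c i = 0 := by
  rw [Finset.sum_mul]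
  exact Finset.sum_eq_zero fun j hj => hc.orthogonal j i fun h => hi (h ▸ hj)

theorem IsJordanFrame.sum_idempotent {r : ℕ} {c : Fin r → E} (hc : IsJordanFrame c)
    (H : Finset (Fin r)) : (∑ h ∈ H, c h) * (∑ h ∈ H, c h) = ∑ h ∈ H, c h := by
  rw [Finset.mul_sum]
  exact Finset.sum_congr rfl fun i hi => hc.sum_mul_of_mem hi

theorem IsJordanFrame.scalingPoint_eq {r : ℕ} {c : Fin r → E} (hc : IsJordanFrame c)
    (H : Finset (Fin r)) (t : ℝ) :
    scalingPoint c H t = t • (∑ h ∈ H, c h) + (1 - ∑ h ∈ H, c h) := by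
  rw [scalingPoint, ← hc.sum_eq_one, ← Finset.sum_add_sum_compl H c, add_sub_cancel_left]

/-- The element is `Q_v 1` for `v = √t p + (1 - p)`. -/
theorem smul_add_one_sub_mem_interior_cone {p : E} (hp : p * p = p) {t : ℝ} (ht : 0 < t) :
    t • p + (1 - p) ∈ interior (cone E) := by
  have h := quadRep_mem_interior_cone hp (Real.sqrt_pos.2 ht).ne' one_mem_interior_cone
  rwa [quadRep_one, smul_add_one_sub_sq hp, Real.sq_sqrt ht.le] at h

theorem isInverse_smul_add_one_sub {p : E} (hp : p * p = p) {s t : ℝ} (hst : s * t = 1) :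
    IsInverse (s • p + (1 - p)) (t • p + (1 - p)) := by
  have hmul : ∀ a b : ℝ, (a • p + (1 - p)) * (b • p + (1 - p)) = (a * b) • p + (1 - p) :=
    fun a b => by
      simp only [add_mul, sub_mul, mul_sub, smul_mul_assoc, mul_smul_comm, mul_add, one_mul,
        mul_one, hp]
      module
  refine ⟨?_, ?_⟩
  · rw [hmul, hst, one_smul, add_sub_cancel]
  · rw [hmul, hmul, mul_assoc, hst, mul_one]

theorem quadRep_scaledRegion_subset {r : ℕ} {c : Fin r → E}
    (hc : IsJordanFrame c) (H : Finset (Fin r)) {t : ℝ} (ht0 : 0 < t) (ht1 : t ≤ 1) :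
    quadRep (scalingPoint c H t) '' scaledRegion E ⊆ cutRegion c H (t ^ 2) := by
  rintro _ ⟨x, ⟨hxi, hx1⟩, rfl⟩
  have hp := hc.sum_idempotent H
  have hin := fun i (hi : i ∈ H) => hc.sum_mul_of_mem hi
  have hout := fun i (hi : i ∉ H) => hc.sum_mul_of_notMem hi
  rw [hc.scalingPoint_eq]
  set p := ∑ h ∈ H, c h
  have hK := one_sub_mem_cone_of_specNorm_le hx1
  have hQi := quadRep_mem_interior_cone hp ht0.ne' hxi
  have hcoeff : ∀ i, inner ℝ (c i) x ≤ (inner ℝ (c i) (c i) : ℝ) := fun i => by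
    have h := inner_idempotent_nonneg_of_mem_cone (hc.idempotent i) hK
    rw [inner_sub_right, ← inner_idempotent_eq (hc.idempotent i) 1, one_mul] at h
    linarith
  have hpos := fun i => real_inner_self_pos.2 (hc.primitive i).1
  refine ⟨hQi, specNorm_le_one (interior_subset hQi) ?_, fun i hi => ?_, fun i hi => ?_⟩
  · have h1 := quadRep_mem_cone hp t hK
    rw [← quadRepLin_apply, map_sub, quadRepLin_apply, quadRepLin_apply, quadRep_one,
      smul_add_one_sub_sq hp] at h1
    have h2 : (1 - t ^ 2) • p ∈ cone E :=
      smul_mem_cone (sub_nonneg.2 (pow_le_one₀ ht0.le ht1)) (idempotent_mem_cone hp)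
    convert add_mem_cone h1 h2 using 1
    module
  -- For `i ∈ H`, `c i` lies in `E_1(p)`, so `Q_g (c i) = t² c i`; off `H` it lies in `E_0(p)` and
  -- is fixed.
  · have e := quadRep_smul_add_one_sub (xh := 0) (x0 := 0) hp t (hin i hi)
      (by rw [mul_zero, smul_zero]) (mul_zero p)
    simp only [smul_zero, add_zero] at e
    rw [(hc.primitive i).traceInner_eq, ← inner_quadRep, e, inner_smul_left,
      RCLike.conj_to_real, div_le_iff₀ (hpos i)]
    exact mul_le_mul_of_nonneg_left (hcoeff i) (sq_nonneg t)
  · have e := quadRep_smul_add_one_sub (x1 := 0) (xh := 0) hp t (mul_zero p)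
      (by rw [mul_zero, smul_zero]) (hout i hi)
    simp only [smul_zero, zero_add] at e
    rw [(hc.primitive i).traceInner_eq, ← inner_quadRep, e, div_le_one (hpos i)]
    exact hcoeff i

end Scaling

end EuclideanJordanAlgebra

theorem mainTheorem2 {E : Type*} [EuclideanJordanAlgebra E] {r : ℕ} (c : Fin r → E)
    (hc : EuclideanJordanAlgebra.IsJordanFrame c) (H : Finset (Fin r)) (hH : H.Nonempty)
    (ξ : ℝ) (hξ0 : 0 < ξ) (hξ1 : ξ < 1) (g : E)
    (hg : g = EuclideanJordanAlgebra.scalingPoint c H (Real.sqrt ξ)) :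
    g ∈ interior (EuclideanJordanAlgebra.cone E) ∧
    EuclideanJordanAlgebra.IsInverse g
      (EuclideanJordanAlgebra.scalingPoint c H (1 / Real.sqrt ξ)) ∧
    EuclideanJordanAlgebra.quadRep g '' EuclideanJordanAlgebra.scaledRegion E ⊆
      EuclideanJordanAlgebra.cutRegion c H ξ := by
  subst hg
  have ht := Real.sqrt_pos.2 hξ0
  have hp := hc.sum_idempotent H
  refine ⟨?_, ?_, ?_⟩
  · rw [hc.scalingPoint_eq]
    exact EuclideanJordanAlgebra.smul_add_one_sub_mem_interior_cone hp ht
  · rw [hc.scalingPoint_eq, hc.scalingPoint_eq]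
    exact EuclideanJordanAlgebra.isInverse_smul_add_one_sub hp (mul_one_div_cancel ht.ne')
  · have h := EuclideanJordanAlgebra.quadRep_scaledRegion_subset hc H ht (Real.sqrt_le_one.2 hξ1.le)
    rwa [Real.sq_sqrt hξ0.le] at h
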